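/- Consider $n$ periodic tasks $\tau_1,\dots,\tau_n$ on one processor, indexed in decreasing order of (distinct) priority, so that $hp(i)=\{j: j<i\}$. Task $\tau_i$ has worst-case execution time $C_i>0$, period $T_i$, relative deadline $D_i$ and phase $\phi_i\ge 0$ (all real), with $C_i\le D_i\le T_i$. Its jobs are released at the times $\phi_i+kT_i$, $k=0,1,2,\dots$; each execution attempt of a job needs an actual execution time in $(0,C_i]$, and the job must complete within $D_i$ of its release. The first $n_c$ tasks are critical. The scheduler is fully preemptive fixed-priority: at each time the pending (released, not completed) job of highest priority executes, jobs of the same task in order of release. The system may be restarted at arbitrary times $\ge 0$, any two restarts being at least $T_r>0$ apart, where $T_r>T_i$ for every critical task $\tau_i$ (this holds in particular if $T_r$ exceeds the least common multiple of the critical periods). A restart makes the processor unavailable for at most $C_r\ge 0$ time units, and every job that is released but not completed at the restart loses all its progress and is re-executed from the beginning with its original priority; completed jobs are not re-executed. The task set is called RBR-feasible under this scheduler if (i) for every such set of restarts (in particular for a single restart at an arbitrary time) and all actual execution times and restart durations within the bounds, the scheduler's schedule exists and every job of every critical task completes by its deadline, and (ii) if there is no restart, every job of every task completes by its deadline. For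 each $i$ let $$\mathcal O_i^p=\begin{cases} C_r+\sum_{j\in hp(i)\cup\{i\}}C_j, & i\le n_c,\\ 0, & i>n_c,\end{cases}\qquad R_i^{(0)}=C_i,\qquad R_i^{(k+1)}=C_i+\sum_{j\in hp(i)}\left\lceil \frac{R_i^{(k)}}{T_j}\right\rceil C_j+\mathcal O_i^p,$$ and let $R_i=R_i^{(k)}$ for the smallest $k$ with $R_i^{(k+1)}=R_i^{(k)}$ (that is, $R_i$ is the least non-negative fixed point of the recursion). **Theorem.** If for every $i=1,\dots,n$ such a $k$ exists and $R_i\le D_i$, then the task set is RBR-feasible under fully preemptive fixed-priority scheduling. -/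

import Mathlib

open MeasureTheory

noncomputable section

/-- A uniprocessor system with `n` periodic tasks. Tasks are indexed in decreasing priority
order, so that `hp i` is `{j | j < i}`, and the first `nc` tasks are the critical ones. -/
structure RBRSystem (n : ℕ) where
  /-- worst-case execution times -/
  C : Fin n → ℝ
  /-- periods -/
  T : Fin n → ℝ
  /-- relative deadlines -/
  D : Fin n → ℝ
  /-- phases: the release time of the first job -/
  phase : Fin n → ℝ
  /-- number of critical tasks -/
  nc : ℕ
  /-- (worst-case) time needed to restart the system -/
  Cr : ℝ
  /-- minimum inter-arrival time of restarts -/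
  Tr : ℝ
  C_pos : ∀ i, 0 < C i
  C_le_D : ∀ i, C i ≤ D i
  D_le_T : ∀ i, D i ≤ T i
  phase_nonneg : ∀ i, 0 ≤ phase i
  Cr_nonneg : 0 ≤ Cr
  Tr_pos : 0 < Tr
  /-- Implied by: `Tr` is larger than the hyper-period of the critical tasks. -/
  T_lt_Tr : ∀ i : Fin n, (i : ℕ) < nc → T i < Tr

/-- The job `(i, k)` is the `k`-th instance of task `i`, with `k` counted from `0`. -/
abbrev RBRJob (n : ℕ) : Type := Fin n × ℕ

/-- A schedule says which job, if any, executes at each time. -/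
abbrev RBRSchedule (n : ℕ) : Type := ℝ → Option (RBRJob n)

namespace RBRSystem

variable {n : ℕ} (sys : RBRSystem n)

/-- Task `i` is critical. -/
def IsCritical (i : Fin n) : Prop := (i : ℕ) < sys.nc

/-- Release time of a job. -/
def release (j : RBRJob n) : ℝ := sys.phase j.1 + j.2 * sys.T j.1

/-- Everything that the scheduler does not control. -/
structure Scenario where
  /-- the instants at which the system is restarted -/
  restarts : Set ℝ
  restarts_nonneg : ∀ s ∈ restarts, 0 ≤ s
  restarts_separated : ∀ s ∈ restarts, ∀ s' ∈ restarts, s < s' → s + sys.Tr ≤ s'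
  /-- `boot s` is the actual duration of the restart that begins at time `s` -/
  boot : ℝ → ℝ
  boot_nonneg : ∀ s, 0 ≤ boot s
  boot_le : ∀ s, boot s ≤ sys.Cr
  /-- `exec j m` is the actual execution time of the attempt at job `j` that is made when
  exactly `m` restarts have taken place -/
  exec : RBRJob n → ℕ → ℝ
  exec_pos : ∀ j m, 0 < exec j m
  exec_le : ∀ j m, exec j m ≤ sys.C j.1

namespace Scenario

variable {sys} (sc : sys.Scenario) (σ : RBRSchedule n)

/-- The processor is unavailable at time `t` because of a restart. -/
def Rebooting (t : ℝ) : Prop := ∃ s ∈ sc.restarts, s ≤ t ∧ t < s + sc.boot s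

/-- Time for which `j` has executed before time `u` since the last restart strictly before `u`
(executions that precede that restart are lost). -/
def progress (j : RBRJob n) (u : ℝ) : ℝ :=
  volume.real {v : ℝ | sys.release j ≤ v ∧ v < u ∧ σ v = some j ∧
    ∀ s ∈ sc.restarts, s ≤ v ∨ u ≤ s}

/-- `j` has completed, in one uninterrupted attempt, at some time `u ≤ t`. -/
def CompletedBy (j : RBRJob n) (t : ℝ) : Prop :=
  ∃ u ≤ t, sc.exec j (sc.restarts ∩ Set.Iio u).ncard ≤ sc.progress σ j u

/-- `j` is released but not completed at time `t`. -/
def Pending (j : RBRJob n) (t : ℝ) : Prop :=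
  sys.release j ≤ t ∧ ¬ sc.CompletedBy σ j t

/-- `σ` is the schedule of the fully preemptive fixed-priority scheduler with restart-based
recovery: unless the system is rebooting, the pending job of highest priority executes (jobs of
one task in order of release). A job interrupted by a restart stays pending, with its progress
reset to zero, and so is re-executed with its original priority. -/
def IsPreemptiveFP : Prop :=
  (∀ j, MeasurableSet {t : ℝ | σ t = some j}) ∧
  ∀ t j, σ t = some j ↔
    ¬ sc.Rebooting t ∧ sc.Pending σ j t ∧
      ∀ j', sc.Pending σ j' t → j.1 < j'.1 ∨ (j.1 = j'.1 ∧ j.2 ≤ j'.2)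

/-- `j` completes no later than its absolute deadline. -/
def MeetsDeadline (j : RBRJob n) : Prop :=
  sc.CompletedBy σ j (sys.release j + sys.D j.1)

end Scenario

/-- RBR-feasibility under fully preemptive fixed-priority scheduling. In every scenario the
scheduler produces a schedule, in which all jobs of critical tasks meet their deadlines; and all
jobs of all tasks meet their deadlines if there is no restart. -/
def RBRFeasible : Prop :=
  (∀ sc : sys.Scenario,
    (∃ σ, sc.IsPreemptiveFP σ) ∧
    ∀ σ, sc.IsPreemptiveFP σ → ∀ i, sys.IsCritical i → ∀ k : ℕ, sc.MeetsDeadline σ (i, k)) ∧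
  (∀ sc : sys.Scenario, sc.restarts = ∅ →
    ∀ σ, sc.IsPreemptiveFP σ → ∀ (i : Fin n) (k : ℕ), sc.MeetsDeadline σ (i, k))

open Classical in
/-- Restart overhead on the response time of task `i`. -/
def overhead (i : Fin n) : ℝ :=
  if sys.IsCritical i then sys.Cr + ∑ j ∈ Finset.Iic i, sys.C j else 0

/-- The iterates `R_i^(k)`, started from `R_i^(0) = C_i`. -/
def responseIter (i : Fin n) : ℕ → ℝ
  | 0 => sys.C i
  | k + 1 => sys.C i + ∑ j ∈ Finset.Iio i, (⌈responseIter i k / sys.T j⌉ : ℝ) * sys.C j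
      + sys.overhead i

/-- `R` is the value of the iteration at the smallest `k` with `R_i^(k+1) = R_i^(k)`. -/
def IsResponseTime (i : Fin n) (R : ℝ) : Prop :=
  ∃ k, IsLeast {k : ℕ | sys.responseIter i (k + 1) = sys.responseIter i k} k ∧
    R = sys.responseIter i k

end RBRSystem

end

namespace RBRSystem

variable {n : ℕ} {sys : RBRSystem n}

/-! Deadlines: suppose job `(i, k)` is late, although all earlier jobs of task `i` are on time. Let
`t₀` be the last quiet instant up to its release (`exists_last_quietAt`). From `t₀` to `t₀ + R` the
processor never idles: it reboots, runs higher-priority jobs released in the window, or runs the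
late job. Since `R ≤ D ≤ T < Tr` for a critical task, the window contains at most one restart, which
costs at most `Cr` plus one repeated execution per task of index at most `i`
(`sum_work_le_of_restart`). The late job, being unfinished, has received strictly less than its
worst-case demand (`work_lt`), so the total is strictly less than the fixed point `R`, the window's
length; `false_of_demand_le` draws this contradiction.

Existence: the service of a job depends only on jobs of higher priority, so the schedule is built by
well-founded recursion on priority. Its self-reference (a job runs until it completes, and
completion depends on when it runs) is harmless because first completion times are attained
(`exists_first`). -/

lemma T_pos (sys : RBRSystem n) (i : Fin n) : 0 < sys.T i :=
  (sys.C_pos i).trans_le ((sys.C_le_D i).trans (sys.D_le_T i))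

lemma overhead_nonneg (sys : RBRSystem n) (i : Fin n) : 0 ≤ sys.overhead i := by
  rw [overhead]
  split_ifs
  · exact add_nonneg sys.Cr_nonneg (Finset.sum_nonneg fun j _ => (sys.C_pos j).le)
  · exact le_rfl

namespace Scenario

/-! ### Completion of a job that is served exactly on a given set of times -/

/-- The times in `A` between `r` and `u` that are not separated from `u` by a restart. -/
def attempt (S : Set ℝ) (r : ℝ) (A : Set ℝ) (u : ℝ) : Set ℝ :=
  {v | r ≤ v ∧ v < u ∧ v ∈ A ∧ ∀ s ∈ S, s ≤ v ∨ u ≤ s}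

lemma attempt_subset_Ico (S : Set ℝ) (r : ℝ) (A : Set ℝ) (u : ℝ) :
    attempt S r A u ⊆ Set.Ico r u := fun _ h => ⟨h.1, h.2.1⟩

lemma measureReal_mono_Ico {A B : Set ℝ} {a b : ℝ} (h : A ⊆ B) (hB : B ⊆ Set.Ico a b) :
    volume.real A ≤ volume.real B :=
  measureReal_mono h (measure_ne_top_of_subset hB measure_Ico_lt_top.ne)

lemma measureReal_le_of_subset_Ico {A : Set ℝ} {a b : ℝ} (hab : a ≤ b) (h : A ⊆ Set.Ico a b) :
    volume.real A ≤ b - a := by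
  have := measureReal_mono_Ico h subset_rfl
  rwa [Real.volume_real_Ico_of_le hab] at this

/-- Job `j`, when served on `A`, completes no later than `t`. -/
def FinishedBy (sc : sys.Scenario) (j : RBRJob n) (A : Set ℝ) (t : ℝ) : Prop :=
  ∃ u ≤ t, sc.exec j (sc.restarts ∩ Set.Iio u).ncard ≤
    volume.real (attempt sc.restarts (sys.release j) A u)

lemma completedBy_iff (sc : sys.Scenario) (σ : RBRSchedule n) (j : RBRJob n) (t : ℝ) :
    sc.CompletedBy σ j t ↔ sc.FinishedBy j {v | σ v = some j} t := Iff.rfl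

lemma FinishedBy.mono {sc : sys.Scenario} {j : RBRJob n} {A : Set ℝ} {t t' : ℝ}
    (h : sc.FinishedBy j A t) (htt : t ≤ t') : sc.FinishedBy j A t' :=
  let ⟨u, hu, hp⟩ := h
  ⟨u, hu.trans htt, hp⟩

lemma exists_restart_free_right (sc : sys.Scenario) (u : ℝ) :
    ∃ w > u, ∀ s ∈ sc.restarts, s ≤ u ∨ w ≤ s := by
  by_cases h : ∃ s ∈ sc.restarts, u < s ∧ s < u + sys.Tr
  · obtain ⟨s, hs, hus, hsu⟩ := h
    refine ⟨s, hus, fun s' hs' => ?_⟩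
    rcases lt_or_ge s' s with hlt | hge
    · exact Or.inl (by linarith [sc.restarts_separated s' hs' s hs hlt])
    · exact Or.inr hge
  · push Not at h
    exact ⟨u + sys.Tr, by linarith [sys.Tr_pos], fun s hs =>
      (le_or_gt s u).imp_right fun hus => h s hs hus⟩

/-- A job that completes has a first completion time. -/
lemma FinishedBy.exists_first {sc : sys.Scenario} {j : RBRJob n} {A : Set ℝ} {t : ℝ}
    (h : sc.FinishedBy j A t) :
    ∃ u ≤ t, sc.exec j (sc.restarts ∩ Set.Iio u).ncard ≤
        volume.real (attempt sc.restarts (sys.release j) A u) ∧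
      ∀ v < u, ¬ sc.FinishedBy j A v := by
  set P : ℝ → ℝ := fun u => volume.real (attempt sc.restarts (sys.release j) A u) with hP
  set S : Set ℝ := {u | sc.exec j (sc.restarts ∩ Set.Iio u).ncard ≤ P u} with hS
  obtain ⟨u₁, hu₁t, hu₁⟩ := h
  have hbdd : BddBelow S := by
    refine ⟨sys.release j, fun u hu => ?_⟩
    by_contra! hlt
    have h0 : P u = 0 := by
      have : attempt sc.restarts (sys.release j) A u = ∅ :=
        Set.eq_empty_of_forall_notMem fun v hv => by linarith [hv.1, hv.2.1]
      simp [hP, this]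
    have : sc.exec j _ ≤ P u := hu
    linarith [sc.exec_pos j (sc.restarts ∩ Set.Iio u).ncard]
  have hne : S.Nonempty := ⟨u₁, hu₁⟩
  -- The infimum is attained: just to its right the restart count is constant. If a restart occurs
  -- at the infimum, progress there starts from zero and cannot yet reach the positive execution
  -- time; otherwise progress is right-continuous and the inequality passes to the limit.
  have hmem : sInf S ∈ S := by
    by_contra hnot
    set u₀ := sInf S with hu₀
    obtain ⟨w, hw, hfree⟩ := sc.exists_restart_free_right u₀
    have key : ∀ ε > 0, ∃ u ∈ S, u₀ < u ∧ u < w ∧ u < u₀ + ε := by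
      intro ε hε
      obtain ⟨u, hu, hlt⟩ := exists_lt_of_csInf_lt hne
        (show sInf S < min w (u₀ + ε) from lt_min hw (by linarith))
      refine ⟨u, hu, lt_of_le_of_ne (csInf_le hbdd hu) ?_, hlt.trans_le (min_le_left _ _),
        hlt.trans_le (min_le_right _ _)⟩
      rintro rfl
      exact hnot hu
    have hcount : ∀ u, u₀ < u → u < w →
        sc.restarts ∩ Set.Iio u = sc.restarts ∩ Set.Iic u₀ := by
      intro u h1 h2
      ext s
      refine and_congr_right fun hs => ⟨fun hsu => ?_, fun hsu => lt_of_le_of_lt hsu h1⟩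
      rcases hfree s hs with h | h
      · exact h
      · exact absurd (Set.mem_Iio.1 hsu) (by linarith)
    by_cases hres : u₀ ∈ sc.restarts
    · obtain ⟨u, hu, h1, h2, h3⟩ := key _ (sc.exec_pos j (sc.restarts ∩ Set.Iic u₀).ncard)
      have hle : sc.exec j _ ≤ P u := hu
      rw [hcount u h1 h2] at hle
      have : P u ≤ u - u₀ := measureReal_le_of_subset_Ico h1.le fun v hv =>
        ⟨(hv.2.2.2 u₀ hres).resolve_right (by linarith), hv.2.1⟩
      linarith
    · apply hnot
      change sc.exec j _ ≤ P u₀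
      refine le_of_forall_pos_le_add fun ε hε => ?_
      obtain ⟨u, hu, h1, h2, h3⟩ := key ε hε
      have hle : sc.exec j _ ≤ P u := hu
      have hcount' : sc.restarts ∩ Set.Iic u₀ = sc.restarts ∩ Set.Iio u₀ := by
        ext s
        refine and_congr_right fun hs => ⟨fun h => Set.mem_Iio.2 (lt_of_le_of_ne h ?_),
          fun h => Set.mem_Iic.2 (Set.mem_Iio.1 h).le⟩
        rintro rfl
        exact hres hs
      rw [hcount u h1 h2, hcount'] at hle
      have hsub : attempt sc.restarts (sys.release j) A u ⊆
          attempt sc.restarts (sys.release j) A u₀ ∪ Set.Ico u₀ u := by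
        intro v hv
        rcases lt_or_ge v u₀ with hlt | hge
        · refine Or.inl ⟨hv.1, hlt, hv.2.2.1, fun s hs => ?_⟩
          rcases hv.2.2.2 s hs with h | h
          · exact Or.inl h
          · exact Or.inr (by linarith)
        · exact Or.inr ⟨hge, hv.2.1⟩
      have hPu : P u ≤ P u₀ + volume.real (Set.Ico u₀ u) := by
        refine (measureReal_mono hsub ?_).trans (measureReal_union_le _ _)
        exact (measure_union_lt_top
          (measure_lt_top_of_subset (attempt_subset_Ico _ _ _ _) measure_Ico_lt_top.ne)
          measure_Ico_lt_top).ne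
      rw [Real.volume_real_Ico_of_le h1.le] at hPu
      linarith
  refine ⟨sInf S, (csInf_le hbdd hu₁).trans hu₁t, hmem, ?_⟩
  rintro v hv ⟨u, huv, hu⟩
  exact absurd (csInf_le hbdd (show u ∈ S from hu)) (by linarith)

/-- Stopping the service of a job once it is complete does not affect its completion. -/
lemma finishedBy_inter_pending_iff (sc : sys.Scenario) (j : RBRJob n) (A : Set ℝ) (t : ℝ) :
    sc.FinishedBy j (A ∩ {v | sys.release j ≤ v ∧ ¬ sc.FinishedBy j A v}) t ↔
      sc.FinishedBy j A t := by
  constructor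
  · rintro ⟨u, hu, h⟩
    exact ⟨u, hu, h.trans (measureReal_mono_Ico
      (fun v hv => ⟨hv.1, hv.2.1, hv.2.2.1.1, hv.2.2.2⟩) (attempt_subset_Ico _ _ _ _))⟩
  · intro h
    obtain ⟨u, hu, hle, hfirst⟩ := h.exists_first
    exact ⟨u, hu, hle.trans (measureReal_mono_Ico
      (fun v hv => ⟨hv.1, hv.2.1, ⟨hv.2.2.1, hv.1, hfirst v hv.2.1⟩, hv.2.2.2⟩)
      (attempt_subset_Ico _ _ _ _))⟩

/-- Completion is irreversible, so these times form an interval, whatever `A` is. -/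
lemma measurableSet_pending (sc : sys.Scenario) (j : RBRJob n) (A : Set ℝ) :
    MeasurableSet {t | sys.release j ≤ t ∧ ¬ sc.FinishedBy j A t} := by
  refine Set.OrdConnected.measurableSet ⟨fun x hx y hy z hz => ?_⟩
  exact ⟨hx.1.trans hz.1, fun h => hy.2 (h.mono hz.2)⟩

/-- Restarts are `Tr` apart, so each cell of length `Tr` contains at most one. -/
lemma restarts_countable (sc : sys.Scenario) : sc.restarts.Countable := by
  refine Set.MapsTo.countable_of_injOn (f := fun s : ℝ => ⌊s / sys.Tr⌋) (t := Set.univ)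
    (fun _ _ => Set.mem_univ _) ?_ Set.countable_univ
  have key : ∀ s ∈ sc.restarts, ∀ s' ∈ sc.restarts, s < s' →
      ⌊s / sys.Tr⌋ ≠ ⌊s' / sys.Tr⌋ := by
    intro s hs s' hs' hlt heq
    have h1 := Int.abs_sub_lt_one_of_floor_eq_floor heq
    have h2 := sc.restarts_separated s hs s' hs' hlt
    rw [abs_sub_comm, ← sub_div, abs_lt, div_lt_one sys.Tr_pos] at h1
    linarith [h1.2]
  intro s hs s' hs' heq
  rcases lt_trichotomy s s' with h | h | h
  · exact absurd heq (key s hs s' hs' h)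
  · exact h
  · exact absurd heq.symm (key s' hs' s hs h)

lemma measurableSet_rebooting (sc : sys.Scenario) : MeasurableSet {t | sc.Rebooting t} := by
  have : {t | sc.Rebooting t} = ⋃ s ∈ sc.restarts, Set.Ico s (s + sc.boot s) := by
    ext t
    simp [Rebooting, and_left_comm]
  rw [this]
  exact MeasurableSet.biUnion sc.restarts_countable fun _ _ => measurableSet_Ico

/-! ### Existence of the schedule -/

/-- `HigherPrio j' j` says that `j'` takes precedence over `j`. -/
def HigherPrio : RBRJob n → RBRJob n → Prop := Prod.Lex (· < ·) (· < ·)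

lemma higherPrio_wf : WellFounded (HigherPrio (n := n)) :=
  WellFounded.prod_lex wellFounded_lt wellFounded_lt

lemma not_higherPrio_iff {j j' : RBRJob n} :
    ¬ HigherPrio j' j ↔ j.1 < j'.1 ∨ (j.1 = j'.1 ∧ j.2 ≤ j'.2) := by
  rw [HigherPrio, Prod.lex_def, not_or, not_and, not_lt, not_lt, le_iff_lt_or_eq]
  constructor
  · rintro ⟨h | h, h'⟩
    · exact Or.inl h
    · exact Or.inr ⟨h, h' h.symm⟩
  · rintro (h | ⟨h, h'⟩)
    · exact ⟨Or.inl h, fun heq => absurd heq h.ne'⟩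
    · exact ⟨Or.inr h, fun _ => h'⟩

lemma higherPrio_or_of_ne {j j' : RBRJob n} (h : j ≠ j') :
    HigherPrio j j' ∨ HigherPrio j' j := by
  by_contra! hn
  rw [not_higherPrio_iff, not_higherPrio_iff] at hn
  obtain ⟨h1, h2⟩ := hn
  rcases h1 with h1 | ⟨e, h1⟩ <;> rcases h2 with h2 | ⟨e', h2⟩
  · exact lt_asymm h1 h2
  · exact h1.ne e'.symm
  · exact h2.ne e.symm
  · exact h (Prod.ext e' (le_antisymm h2 h1))

/-- The times left over for `j` if every job `j'` of higher priority is served on `run j'`. -/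
def available (sc : sys.Scenario) (j : RBRJob n) (run : ∀ j', HigherPrio j' j → Set ℝ) :
    Set ℝ :=
  {t | ¬ sc.Rebooting t ∧ ∀ j' (h : HigherPrio j' j),
    ¬ (sys.release j' ≤ t ∧ ¬ sc.FinishedBy j' (run j' h) t)}

lemma exists_run (sc : sys.Scenario) : ∃ run : RBRJob n → Set ℝ, ∀ j,
    run j = sc.available j (fun j' _ => run j') ∩ {t | sys.release j ≤ t ∧
      ¬ sc.FinishedBy j (sc.available j (fun j' _ => run j')) t} := by
  let F : ∀ j : RBRJob n, (∀ j', HigherPrio j' j → Set ℝ) → Set ℝ := fun j run =>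
    sc.available j run ∩ {t | sys.release j ≤ t ∧ ¬ sc.FinishedBy j (sc.available j run) t}
  exact ⟨higherPrio_wf.fix F, fun j => higherPrio_wf.fix_eq F j⟩

lemma exists_isPreemptiveFP (sc : sys.Scenario) : ∃ σ, sc.IsPreemptiveFP σ := by
  classical
  obtain ⟨run, hrun⟩ := sc.exists_run
  -- The recursion tests completion against all available time; this replaces that test by
  -- completion under the actual service, as the scheduler requires.
  have hfin : ∀ j t, sc.FinishedBy j (sc.available j fun j' _ => run j') t ↔
      sc.FinishedBy j (run j) t := by
    intro j t
    conv_rhs => rw [hrun j]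
    exact (sc.finishedBy_inter_pending_iff j _ t).symm
  have hmem : ∀ j t, t ∈ run j ↔ ¬ sc.Rebooting t ∧
      (sys.release j ≤ t ∧ ¬ sc.FinishedBy j (run j) t) ∧
      ∀ j', sys.release j' ≤ t ∧ ¬ sc.FinishedBy j' (run j') t → ¬ HigherPrio j' j := by
    intro j t
    rw [hrun j, Set.mem_inter_iff, Set.mem_ofPred_eq, hfin, ← hrun j]
    simp only [available, Set.mem_ofPred_eq]
    constructor
    · rintro ⟨⟨h1, h2⟩, h3⟩
      exact ⟨h1, h3, fun j' hp hh => h2 j' hh hp⟩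
    · rintro ⟨h1, h3, h2⟩
      exact ⟨⟨h1, fun j' hh hp => h2 j' hp hh⟩, h3⟩
  have huniq : ∀ j j' t, t ∈ run j → t ∈ run j' → j = j' := by
    intro j j' t hj hj'
    by_contra hne
    rw [hmem] at hj hj'
    rcases higherPrio_or_of_ne hne with h | h
    · exact hj'.2.2 j hj.2.1 h
    · exact hj.2.2 j' hj'.2.1 h
  let σ : RBRSchedule n := fun t => if h : ∃ j, t ∈ run j then some h.choose else none
  have hσ : ∀ t j, σ t = some j ↔ t ∈ run j := by
    intro t j
    by_cases h : ∃ j, t ∈ run j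
    · simp only [σ, h, dif_pos, Option.some.injEq]
      exact ⟨fun e => e ▸ h.choose_spec, fun hj => huniq _ _ t h.choose_spec hj⟩
    · simp only [σ, h, dif_neg, not_false_eq_true, reduceCtorEq, false_iff]
      exact fun hj => h ⟨j, hj⟩
  have hset : ∀ j, {t | σ t = some j} = run j := fun j => Set.ext fun t => hσ t j
  refine ⟨σ, fun j => ?_, fun t j => ?_⟩
  · rw [hset, hrun]
    refine MeasurableSet.inter ?_ (sc.measurableSet_pending _ _)
    -- No induction on priority is needed: each pending set is an interval regardless of `run`, and
    -- there are countably many jobs.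
    have : sc.available j (fun j' _ => run j') = {t | sc.Rebooting t}ᶜ ∩
        ⋂ j' ∈ {j' | HigherPrio j' j},
          {t | sys.release j' ≤ t ∧ ¬ sc.FinishedBy j' (run j') t}ᶜ := by
      ext t
      simp only [available, Set.mem_inter_iff, Set.mem_iInter, Set.mem_compl_iff,
        Set.mem_ofPred_eq]
    rw [this]
    exact sc.measurableSet_rebooting.compl.inter (MeasurableSet.biInter
      (Set.to_countable _) fun j' _ => (sc.measurableSet_pending _ _).compl)
  · rw [hσ, hmem]
    simp only [Pending, completedBy_iff, hset, not_higherPrio_iff]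

/-! ### Demand bounds -/

lemma Pending.of_le {sc : sys.Scenario} {σ : RBRSchedule n} {j : RBRJob n} {t t' : ℝ}
    (h : sc.Pending σ j t') (hr : sys.release j ≤ t) (ht : t ≤ t') : sc.Pending σ j t :=
  ⟨hr, fun hc => h.2 (FinishedBy.mono hc ht)⟩

section Demand

variable {sc : sys.Scenario} {σ : RBRSchedule n}

lemma IsPreemptiveFP.pending (hσ : sc.IsPreemptiveFP σ) {t : ℝ} {j : RBRJob n}
    (h : σ t = some j) : sc.Pending σ j t := ((hσ.2 t j).1 h).2.1

/-- Unless the system is rebooting, a pending job executes or is held up by a job of higher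
priority. -/
lemma IsPreemptiveFP.exists_executing (hσ : sc.IsPreemptiveFP σ) {t : ℝ} {j : RBRJob n}
    (ht : ¬ sc.Rebooting t) (hj : sc.Pending σ j t) :
    ∃ j', σ t = some j' ∧ (j'.1 < j.1 ∨ (j'.1 = j.1 ∧ j'.2 ≤ j.2)) := by
  obtain ⟨j', hj', hmin⟩ := higherPrio_wf.has_min {j | sc.Pending σ j t} ⟨j, hj⟩
  exact ⟨j', (hσ.2 t j').2 ⟨ht, hj', fun l hl => not_higherPrio_iff.1 (hmin l hl)⟩,
    not_higherPrio_iff.1 (hmin j hj)⟩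

/-- Jobs of one task execute in order of release. -/
lemma IsPreemptiveFP.instance_le_of_le (hσ : sc.IsPreemptiveFP σ) {i : Fin n} {k l : ℕ}
    {v w : ℝ} (hv : σ v = some (i, k)) (hw : σ w = some (i, l)) (hvw : v ≤ w) : k ≤ l := by
  by_contra! hlt
  have hrel : sys.release (i, l) ≤ sys.release (i, k) := by
    have : (l : ℝ) ≤ k := by exact_mod_cast hlt.le
    simp only [release]
    nlinarith [sys.T_pos i]
  have hp : sc.Pending σ (i, l) v :=
    (hσ.pending hw).of_le (hrel.trans (hσ.pending hv).1) hvw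
  rcases ((hσ.2 v (i, k)).1 hv).2.2 _ hp with h | ⟨-, h⟩
  · exact lt_irrefl _ h
  · exact absurd h (by simpa using hlt)

/-- With no restart strictly inside the window, all this work still counts as progress at `b`, where
the attempt is incomplete. -/
lemma IsPreemptiveFP.work_lt (hσ : sc.IsPreemptiveFP σ) {j : RBRJob n} {a b : ℝ}
    (hfree : ∀ s ∈ sc.restarts, s ≤ a ∨ b ≤ s) (hb : ¬ sc.CompletedBy σ j b) :
    volume.real ({t | σ t = some j} ∩ Set.Ico a b) < sys.C j.1 := by
  have h1 : sc.progress σ j b < sc.exec j (sc.restarts ∩ Set.Iio b).ncard := by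
    by_contra! h
    exact hb ⟨b, le_rfl, h⟩
  refine lt_of_le_of_lt ?_ (h1.trans_le (sc.exec_le _ _))
  refine measureReal_mono_Ico (fun v hv => ?_)
    (attempt_subset_Ico sc.restarts (sys.release j) {t | σ t = some j} b)
  exact ⟨(hσ.pending hv.1).1, hv.2.2, hv.1, fun s hs =>
    (hfree s hs).imp_left fun h => h.trans hv.2.1⟩

/-- A job is pending whenever it executes, so `work_lt` applies up to an execution instant within
`ε` of the last one. -/
lemma IsPreemptiveFP.work_le (hσ : sc.IsPreemptiveFP σ) {j : RBRJob n} {a b : ℝ}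
    (hfree : ∀ s ∈ sc.restarts, s ≤ a ∨ b ≤ s) :
    volume.real ({t | σ t = some j} ∩ Set.Ico a b) ≤ sys.C j.1 := by
  set E := {t | σ t = some j} ∩ Set.Ico a b with hE
  rcases E.eq_empty_or_nonempty with h0 | hne
  · simpa [h0] using (sys.C_pos j.1).le
  have hbdd : BddAbove E := ⟨b, fun v hv => hv.2.2.le⟩
  refine le_of_forall_pos_le_add fun ε hε => ?_
  obtain ⟨v, hv, hlt⟩ := exists_lt_of_lt_csSup hne (sub_lt_self (sSup E) hε)
  have hvs : v ≤ sSup E := le_csSup hbdd hv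
  have h1 := hσ.work_lt (j := j) (a := a) (b := v)
    (fun s hs => (hfree s hs).imp_right fun h => hv.2.2.le.trans h) (hσ.pending hv.1).2
  have hsub : E ⊆ ({t | σ t = some j} ∩ Set.Ico a v) ∪ Set.Icc v (sSup E) := by
    intro x hx
    rcases lt_or_ge x v with h | h
    · exact Or.inl ⟨hx.1, hx.2.1, h⟩
    · exact Or.inr ⟨h, le_csSup hbdd hx⟩
  have h2 : volume.real E ≤ volume.real ({t | σ t = some j} ∩ Set.Ico a v) +
      volume.real (Set.Icc v (sSup E)) := by
    refine (measureReal_mono hsub ?_).trans (measureReal_union_le _ _)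
    exact (measure_union_lt_top
      (measure_lt_top_of_subset Set.inter_subset_right measure_Ico_lt_top.ne)
      measure_Icc_lt_top).ne
  rw [Real.volume_real_Icc_of_le hvs] at h2
  linarith

lemma measureReal_inter_Ico_le_add (E : Set ℝ) (a s b : ℝ) :
    volume.real (E ∩ Set.Ico a b) ≤
      volume.real (E ∩ Set.Ico a s) + volume.real (E ∩ Set.Ico s b) := by
  refine (measureReal_mono ?_ ?_).trans (measureReal_union_le _ _)
  · intro x hx
    rcases lt_or_ge x s with h | h
    · exact Or.inl ⟨hx.1, hx.2.1, h⟩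
    · exact Or.inr ⟨hx.1, h, hx.2.2⟩
  · exact (measure_union_lt_top
      (measure_lt_top_of_subset Set.inter_subset_right measure_Ico_lt_top.ne)
      (measure_lt_top_of_subset Set.inter_subset_right measure_Ico_lt_top.ne)).ne

/-- A single restart costs a task at most one additional execution, because at most one of its
jobs executes both before and after the restart. -/
lemma IsPreemptiveFP.sum_work_le_of_restart (hσ : sc.IsPreemptiveFP σ) (i : Fin n)
    (K : Finset ℕ) {a s b : ℝ} (hfree : ∀ s' ∈ sc.restarts, s' ≤ a ∨ s ≤ s')
    (hfree' : ∀ s' ∈ sc.restarts, s' ≤ s ∨ b ≤ s') :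
    ∑ k ∈ K, volume.real ({t | σ t = some (i, k)} ∩ Set.Ico a b) ≤
      K.card * sys.C i + sys.C i := by
  have hC := (sys.C_pos i).le
  let before : ℕ → Set ℝ := fun k => {t | σ t = some (i, k)} ∩ Set.Ico a s
  let after : ℕ → Set ℝ := fun k => {t | σ t = some (i, k)} ∩ Set.Ico s b
  have hb : ∀ k, volume.real (before k) ≤ sys.C i := fun k => hσ.work_le hfree
  have ha : ∀ k, volume.real (after k) ≤ sys.C i := fun k => hσ.work_le hfree'
  have hsplit : ∀ k, volume.real ({t | σ t = some (i, k)} ∩ Set.Ico a b) ≤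
      volume.real (before k) + volume.real (after k) :=
    fun k => measureReal_inter_Ico_le_add _ a s b
  have hle : ∀ k l, (before k).Nonempty → (after l).Nonempty → k ≤ l := by
    rintro k l ⟨v, hv⟩ ⟨w, hw⟩
    exact hσ.instance_le_of_le hv.1 hw.1 (hv.2.2.le.trans hw.2.1)
  have hone : ∀ k, ¬ ((before k).Nonempty ∧ (after k).Nonempty) →
      volume.real ({t | σ t = some (i, k)} ∩ Set.Ico a b) ≤ sys.C i := by
    intro k hk
    refine (hsplit k).trans ?_
    rw [not_and_or, Set.not_nonempty_iff_eq_empty, Set.not_nonempty_iff_eq_empty] at hk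
    rcases hk with h | h
    · simpa [h] using ha k
    · simpa [h] using hb k
  by_cases hex : ∃ k₀, (before k₀).Nonempty ∧ (after k₀).Nonempty
  · obtain ⟨k₀, hk₀⟩ := hex
    have hk : ∀ k ∈ K, volume.real ({t | σ t = some (i, k)} ∩ Set.Ico a b) ≤
        sys.C i + if k = k₀ then sys.C i else 0 := by
      intro k _
      split_ifs with h
      · exact (hsplit k).trans (add_le_add (hb k) (ha k))
      · rw [add_zero]
        exact hone k fun hk => h (le_antisymm (hle _ _ hk.1 hk₀.2) (hle _ _ hk₀.1 hk.2))
    refine (Finset.sum_le_sum hk).trans ?_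
    rw [Finset.sum_add_distrib, Finset.sum_const, nsmul_eq_mul, Finset.sum_ite_eq']
    split_ifs <;> linarith
  · push Not at hex
    refine (Finset.sum_le_card_nsmul K _ (sys.C i) fun k _ => hone k ?_).trans ?_
    · rintro ⟨h1, h2⟩
      exact h2.ne_empty (by simpa [Set.not_nonempty_iff_eq_empty] using hex k h1)
    · rw [nsmul_eq_mul]
      linarith

end Demand

/-- The instances of task `i` that are released in `[a, b)`. -/
noncomputable def released (sys : RBRSystem n) (i : Fin n) (a b : ℝ) : Finset ℕ :=
  Finset.Ico ⌈(a - sys.phase i) / sys.T i⌉₊ ⌈(b - sys.phase i) / sys.T i⌉₊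

lemma mem_released {i : Fin n} {a b : ℝ} {k : ℕ} (ha : a ≤ sys.release (i, k))
    (hb : sys.release (i, k) < b) : k ∈ released sys i a b := by
  simp only [release] at ha hb
  rw [released, Finset.mem_Ico, Nat.ceil_le, Nat.lt_ceil, div_le_iff₀ (sys.T_pos i),
    lt_div_iff₀ (sys.T_pos i)]
  constructor <;> linarith

/-- Subadditivity of the ceiling, so neither the phase nor the position of the window matters. -/
lemma card_released_le (i : Fin n) (a : ℝ) {R : ℝ} (hR : 0 < R) :
    ((released sys i a (a + R)).card : ℝ) ≤ ⌈R / sys.T i⌉ := by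
  have h1 : (released sys i a (a + R)).card ≤ ⌈R / sys.T i⌉₊ := by
    rw [released, Nat.card_Ico, Nat.sub_le_iff_le_add']
    have : (a + R - sys.phase i) / sys.T i = (a - sys.phase i) / sys.T i + R / sys.T i := by
      ring
    rw [this]
    exact Nat.ceil_add_le _ _
  have h2 : ((⌈R / sys.T i⌉₊ : ℕ) : ℝ) = (⌈R / sys.T i⌉ : ℝ) :=
    natCast_ceil_eq_intCast_ceil (div_pos hR (sys.T_pos i)).le
  rw [← h2]
  exact_mod_cast h1

/-! ### The busy window -/

/-- At time `t` no reboot is in progress and no earlier job of a task above `i` is pending. -/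
def QuietAt (sc : sys.Scenario) (σ : RBRSchedule n) (i : Fin n) (t : ℝ) : Prop :=
  (∀ j : RBRJob n, j.1 < i → sys.release j < t → sc.CompletedBy σ j t) ∧
    ∀ s ∈ sc.restarts, s < t → s + sc.boot s ≤ t

lemma release_nonneg (j : RBRJob n) : 0 ≤ sys.release j :=
  add_nonneg (sys.phase_nonneg _) (mul_nonneg (Nat.cast_nonneg _) (sys.T_pos _).le)

/-- The strict inequalities in `QuietAt` make it survive limits from the left, so the supremum of
quiet instants is quiet; time `0` is quiet because nothing precedes it. -/
lemma exists_last_quietAt (sc : sys.Scenario) (σ : RBRSchedule n) (i : Fin n) {r : ℝ}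
    (hr : 0 ≤ r) :
    ∃ t₀ ≤ r, sc.QuietAt σ i t₀ ∧ ∀ t, t₀ < t → t ≤ r → ¬ sc.QuietAt σ i t := by
  set Q : Set ℝ := {t | t ≤ r ∧ sc.QuietAt σ i t} with hQ
  have h0 : (0 : ℝ) ∈ Q := ⟨hr, fun j _ h => absurd h (release_nonneg j).not_gt,
    fun s hs h => absurd h (sc.restarts_nonneg s hs).not_gt⟩
  have hbdd : BddAbove Q := ⟨r, fun t ht => ht.1⟩
  refine ⟨sSup Q, csSup_le ⟨0, h0⟩ fun t ht => ht.1, ⟨fun j hj hlt => ?_, fun s hs hlt => ?_⟩,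
    fun t ht htr hq => absurd (le_csSup hbdd (show t ∈ Q from ⟨htr, hq⟩)) ht.not_ge⟩
  · obtain ⟨t, ht, hjt⟩ := exists_lt_of_lt_csSup ⟨0, h0⟩ hlt
    exact FinishedBy.mono (ht.2.1 j hj hjt) (le_csSup hbdd ht)
  · obtain ⟨t, ht, hst⟩ := exists_lt_of_lt_csSup ⟨0, h0⟩ hlt
    exact (ht.2.2 s hs hst).trans (le_csSup hbdd ht)

/-- A job whose predecessors have completed at its release cannot be outstanding at the end of
a window that starts at a quiet instant and exceeds the demand of the job and of the tasks above
it: `reboot` bounds the reboot time and `lost j` the work of task `j` lost in the window. -/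
lemma false_of_demand_le {sc : sys.Scenario} {σ : RBRSchedule n} (hσ : sc.IsPreemptiveFP σ)
    {i : Fin n} {k : ℕ} {t₀ R reboot : ℝ} {lost : Fin n → ℝ} (hR : 0 < R)
    (hprev : ∀ k' < k, sc.CompletedBy σ (i, k') (sys.release (i, k)))
    (hquiet : sc.QuietAt σ i t₀)
    (hbusy : ∀ t, t₀ < t → t ≤ sys.release (i, k) → ¬ sc.QuietAt σ i t)
    (hpend : ¬ sc.CompletedBy σ (i, k) (t₀ + R))
    (hreboot : volume.real ({t | sc.Rebooting t} ∩ Set.Ico t₀ (t₀ + R)) ≤ reboot)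
    (hhp : ∀ j < i, ∀ K : Finset ℕ,
      ∑ l ∈ K, volume.real ({t | σ t = some (j, l)} ∩ Set.Ico t₀ (t₀ + R)) ≤
        K.card * sys.C j + lost j)
    (hown : volume.real ({t | σ t = some (i, k)} ∩ Set.Ico t₀ (t₀ + R)) < sys.C i + lost i)
    (hdemand : sys.C i + ∑ j ∈ Finset.Iio i, (⌈R / sys.T j⌉ : ℝ) * sys.C j +
      (reboot + ∑ j ∈ Finset.Iic i, lost j) ≤ R) : False := by
  set W := Set.Ico t₀ (t₀ + R) with hW
  let K : Fin n → Finset ℕ := fun j => released sys j t₀ (t₀ + R)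
  -- Open at `t₀`, since quietness fails only afterwards; the lost endpoint is null.
  have hcover : Set.Ioo t₀ (t₀ + R) ⊆ ({t | sc.Rebooting t} ∩ W) ∪
      ((⋃ j ∈ Finset.Iio i, ⋃ l ∈ K j, {t | σ t = some (j, l)} ∩ W) ∪
        ({t | σ t = some (i, k)} ∩ W)) := by
    intro t ht
    have htW : t ∈ W := ⟨ht.1.le, ht.2⟩
    by_cases hreb : sc.Rebooting t
    · exact Or.inl ⟨hreb, htW⟩
    refine Or.inr ?_
    have hexec : ∃ j, σ t = some j ∧ (j.1 < i ∨ j = (i, k)) := by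
      rcases lt_or_ge t (sys.release (i, k)) with hlt | hge
      · have hnq := hbusy t ht.1 hlt.le
        rw [QuietAt, not_and_or] at hnq
        rcases hnq with h | h
        · push Not at h
          obtain ⟨j, hji, hjt, hjc⟩ := h
          obtain ⟨j', hj', h'⟩ := hσ.exists_executing hreb ⟨hjt.le, hjc⟩
          exact ⟨j', hj', Or.inl (h'.elim (fun h => h.trans hji) fun h => h.1 ▸ hji)⟩
        · push Not at h
          obtain ⟨s, hs, hst, hts⟩ := h
          exact absurd ⟨s, hs, hst.le, hts⟩ hreb
      · obtain ⟨j', hj', h'⟩ := hσ.exists_executing (j := (i, k)) hreb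
          ⟨hge, fun hc => hpend (FinishedBy.mono hc ht.2.le)⟩
        refine ⟨j', hj', h'.imp_right fun h => Prod.ext h.1 ?_⟩
        refine le_antisymm h.2 (le_of_not_gt fun hlt => ?_)
        obtain ⟨i', k'⟩ := j'
        obtain rfl : i' = i := h.1
        exact (hσ.pending hj').2 (FinishedBy.mono (hprev k' hlt) hge)
    obtain ⟨⟨j, l⟩, hjl, hj | hj⟩ := hexec
    · have hp := hσ.pending hjl
      refine Or.inl ?_
      simp only [Set.mem_iUnion, Finset.mem_Iio]
      -- A higher-priority job released before `t₀` was complete at the quiet instant, so one that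
      -- runs now was released in the window.
      refine ⟨j, hj, l, mem_released ?_ (hp.1.trans_lt ht.2), hjl, htW⟩
      by_contra! hlt
      exact hp.2 (FinishedBy.mono (hquiet.1 _ hj hlt) ht.1.le)
    · exact Or.inr ⟨hj ▸ hjl, htW⟩
  have hWfin : ∀ E : Set ℝ, E ⊆ W → volume E ≠ ⊤ :=
    fun E hE => measure_ne_top_of_subset hE measure_Ico_lt_top.ne
  have htotal : R ≤ volume.real ({t | sc.Rebooting t} ∩ W) +
      (∑ j ∈ Finset.Iio i, ∑ l ∈ K j, volume.real ({t | σ t = some (j, l)} ∩ W) +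
        volume.real ({t | σ t = some (i, k)} ∩ W)) := by
    have hlen : volume.real (Set.Ioo t₀ (t₀ + R)) = R := by
      rw [Real.volume_real_Ioo_of_le (by linarith)]
      ring
    rw [← hlen]
    refine (measureReal_mono hcover (hWfin _ ?_)).trans ((measureReal_union_le _ _).trans
      (add_le_add_right ((measureReal_union_le _ _).trans (add_le_add_left
        ((measureReal_biUnion_finset_le _ _).trans (Finset.sum_le_sum fun j _ =>
          measureReal_biUnion_finset_le _ _)) _)) _))
    refine Set.union_subset Set.inter_subset_right (Set.union_subset ?_ Set.inter_subset_right)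
    exact Set.iUnion₂_subset fun j _ => Set.iUnion₂_subset fun l _ => Set.inter_subset_right
  have hsum : ∑ j ∈ Finset.Iio i, ∑ l ∈ K j, volume.real ({t | σ t = some (j, l)} ∩ W) ≤
      ∑ j ∈ Finset.Iio i, (⌈R / sys.T j⌉ : ℝ) * sys.C j + ∑ j ∈ Finset.Iio i, lost j := by
    rw [← Finset.sum_add_distrib]
    refine Finset.sum_le_sum fun j hj => (hhp j (Finset.mem_Iio.1 hj) (K j)).trans ?_
    have := mul_le_mul_of_nonneg_right (card_released_le (sys := sys) j t₀ hR) (sys.C_pos j).le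
    linarith
  have hIic : ∑ j ∈ Finset.Iic i, lost j = lost i + ∑ j ∈ Finset.Iio i, lost j := by
    rw [← Finset.Iio_insert, Finset.sum_insert (by simp)]
  linarith

/-- If the response-time recursion of task `i` has a fixed point within the deadline, all jobs
of the task meet their deadlines, unless the task is non-critical and there are restarts. -/
lemma IsPreemptiveFP.meetsDeadline {sc : sys.Scenario} {σ : RBRSchedule n}
    (hσ : sc.IsPreemptiveFP σ) {i : Fin n} {R : ℝ} (hR : 0 < R)
    (hfix : sys.C i + ∑ j ∈ Finset.Iio i, (⌈R / sys.T j⌉ : ℝ) * sys.C j + sys.overhead i = R)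
    (hRD : R ≤ sys.D i) (hrestart : sc.restarts.Nonempty → sys.IsCritical i) (k : ℕ) :
    sc.MeetsDeadline σ (i, k) := by
  induction k using Nat.strong_induction_on with
  | _ k ih =>
  by_contra hmiss
  have hprev : ∀ k' < k, sc.CompletedBy σ (i, k') (sys.release (i, k)) := by
    intro k' hk'
    refine FinishedBy.mono (ih k' hk') ?_
    have h1 : (k' : ℝ) + 1 ≤ k := by exact_mod_cast hk'
    simp only [release]
    nlinarith [sys.T_pos i, sys.D_le_T i]
  obtain ⟨t₀, ht₀, hquiet, hbusy⟩ :=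
    sc.exists_last_quietAt σ i (release_nonneg (sys := sys) (i, k))
  have hpend : ¬ sc.CompletedBy σ (i, k) (t₀ + R) := fun hc =>
    hmiss (FinishedBy.mono hc (add_le_add ht₀ hRD))
  -- A reboot begun before `t₀` is over by then, so reboot time in the window is due to restarts at
  -- or after `t₀`.
  have hlate : ∀ s ∈ sc.restarts, ∀ t, t₀ ≤ t → s ≤ t → t < s + sc.boot s → t₀ ≤ s := by
    intro s hs t h1 h2 h3
    by_contra! hlt
    linarith [hquiet.2 s hs hlt]
  by_cases hex : ∃ s ∈ sc.restarts, t₀ ≤ s ∧ s < t₀ + R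
  · obtain ⟨s, hs, hts, hst⟩ := hex
    have hcrit := hrestart ⟨s, hs⟩
    have hRT : R < sys.Tr := (hRD.trans (sys.D_le_T i)).trans_lt (sys.T_lt_Tr i hcrit)
    have huniq : ∀ s' ∈ sc.restarts, t₀ ≤ s' → s' < t₀ + R → s' = s := by
      intro s' hs' h1 h2
      rcases lt_trichotomy s' s with h | h | h
      · linarith [sc.restarts_separated s' hs' s hs h]
      · exact h
      · linarith [sc.restarts_separated s hs s' hs' h]
    have hfree : ∀ s' ∈ sc.restarts, s' ≤ t₀ ∨ s ≤ s' := by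
      intro s' hs'
      by_contra! h
      linarith [huniq s' hs' h.1.le (h.2.trans hst)]
    have hfree' : ∀ s' ∈ sc.restarts, s' ≤ s ∨ t₀ + R ≤ s' := by
      intro s' hs'
      by_contra! h
      linarith [huniq s' hs' (hts.trans h.1.le) h.2]
    refine false_of_demand_le hσ (reboot := sys.Cr) (lost := sys.C) hR hprev hquiet hbusy hpend
      ?_ (fun j _ K => hσ.sum_work_le_of_restart j K hfree hfree') ?_ ?_
    · have hsub : {t | sc.Rebooting t} ∩ Set.Ico t₀ (t₀ + R) ⊆ Set.Ico s (s + sc.boot s) := by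
        rintro t ⟨⟨s', hs', h1, h2⟩, h3⟩
        obtain rfl := huniq s' hs' (hlate s' hs' t h3.1 h1 h2) (h1.trans_lt h3.2)
        exact ⟨h1, h2⟩
      have := measureReal_le_of_subset_Ico (by linarith [sc.boot_nonneg s]) hsub
      linarith [sc.boot_le s]
    -- The attempt before the restart may use all of `C i`; the one after it is unfinished, which
    -- gives the strictness.
    · refine (measureReal_inter_Ico_le_add _ _ s _).trans_lt ?_
      rw [add_comm]
      exact add_lt_add_of_lt_of_le (hσ.work_lt hfree' hpend) (hσ.work_le hfree)
    · rw [overhead, if_pos hcrit] at hfix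
      exact hfix.le
  · push Not at hex
    have hfree : ∀ s ∈ sc.restarts, s ≤ t₀ ∨ t₀ + R ≤ s := fun s hs =>
      (le_total s t₀).imp_right (hex s hs)
    refine false_of_demand_le hσ (reboot := 0) (lost := 0) hR hprev hquiet hbusy hpend
      ?_ (fun j _ K => ?_) ?_ ?_
    · have hempty : {t | sc.Rebooting t} ∩ Set.Ico t₀ (t₀ + R) = ∅ := by
        refine Set.eq_empty_of_forall_notMem ?_
        rintro t ⟨⟨s', hs', h1, h2⟩, h3⟩
        linarith [hex s' hs' (hlate s' hs' t h3.1 h1 h2), h3.2]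
      simp [hempty]
    · refine (Finset.sum_le_card_nsmul K _ (sys.C j) fun l _ => hσ.work_le hfree).trans ?_
      simp
    · simpa using hσ.work_lt hfree hpend
    -- Without a restart the overhead is spare room in the fixed-point equation.
    · simp only [Pi.zero_apply, Finset.sum_const_zero, add_zero]
      linarith [sys.overhead_nonneg i]

end Scenario

/-! ### Response times as positive fixed points -/

lemma responseIter_pos (sys : RBRSystem n) (i : Fin n) (k : ℕ) : 0 < sys.responseIter i k := by
  induction k with
  | zero => exact sys.C_pos i
  | succ k ih =>
    have h : 0 ≤ ∑ j ∈ Finset.Iio i, (⌈sys.responseIter i k / sys.T j⌉ : ℝ) * sys.C j :=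
      Finset.sum_nonneg fun j _ => mul_nonneg
        (by exact_mod_cast Int.ceil_nonneg (div_pos ih (sys.T_pos j)).le) (sys.C_pos j).le
    rw [responseIter]
    linarith [sys.C_pos i, sys.overhead_nonneg i]

lemma IsResponseTime.pos {i : Fin n} {R : ℝ} (h : sys.IsResponseTime i R) : 0 < R := by
  obtain ⟨k, -, rfl⟩ := h
  exact sys.responseIter_pos i k

lemma IsResponseTime.fixed_point {i : Fin n} {R : ℝ} (h : sys.IsResponseTime i R) :
    sys.C i + ∑ j ∈ Finset.Iio i, (⌈R / sys.T j⌉ : ℝ) * sys.C j + sys.overhead i = R := by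
  obtain ⟨k, hk, rfl⟩ := h
  exact hk.1

end RBRSystem

theorem mainTheorem1 {n : ℕ} (sys : RBRSystem n) (R : Fin n → ℝ)
    (hR : ∀ i, sys.IsResponseTime i (R i)) (hD : ∀ i, R i ≤ sys.D i) :
    sys.RBRFeasible := by
  refine ⟨fun sc => ⟨sc.exists_isPreemptiveFP, fun σ hσ i hi k => ?_⟩,
    fun sc hsc σ hσ i k => ?_⟩
  · exact hσ.meetsDeadline (hR i).pos (hR i).fixed_point (hD i) (fun _ => hi) k
  · refine hσ.meetsDeadline (hR i).pos (hR i).fixed_point (hD i) (fun h => ?_) k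
    rw [hsc] at h
    exact absurd h Set.not_nonempty_empty
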